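/- Let $G$ be a finite simple graph in which every vertex has degree $3$. Suppose that $G$ is a circle graph, i.e., that $G$ is the interlacement graph of a word in which every vertex of $G$ appears exactly twice and no other letter appears: two distinct vertices $a,b$ are adjacent in $G$ if and only if their occurrences appear in the word in the order $abab$ or $baba$. If $G$ is isomorphic neither to the complete graph $K_4$ nor to the complete bipartite graph $K_{3,3}$, then $G$ is not $3$-connected. Equivalently, every $3$-connected $3$-regular circle graph is isomorphic to $K_4$ or $K_{3,3}$. (Here a graph is $3$-connected if it has more than three vertices and remains connected whenever at most two vertices are deleted.) -/

import Mathlib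

namespace SimpleGraph

/-- A word `W` in which every element of the vertex set `V` appears exactly twice (and whose letters
are therefore exactly the elements of `V`). -/
def IsDoubleOccurrenceWord {V : Type*} [DecidableEq V] (W : List V) : Prop :=
  ∀ v : V, W.count v = 2

/-- The interlacement graph of a word: distinct letters `a` and `b` are adjacent if and only if they
appear in `W` in the order `a b a b` or `b a b a`. -/
def interlacementGraph {V : Type*} (W : List V) : SimpleGraph V where
  Adj a b := a ≠ b ∧ (List.Sublist [a, b, a, b] W ∨ List.Sublist [b, a, b, a] W)
  symm := ⟨fun _ _ h => ⟨h.1.symm, h.2.symm⟩⟩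
  loopless := ⟨fun _ h => h.1 rfl⟩

/-- A circle graph: the interlacement graph of a double occurrence word whose letters are the
vertices. -/
def IsCircleGraph {V : Type*} [DecidableEq V] (G : SimpleGraph V) : Prop :=
  ∃ W : List V, IsDoubleOccurrenceWord W ∧ G = interlacementGraph W

/-- `k`-connectedness in the sense of vertex connectivity: `G` has more than `k` vertices, and
it remains connected whenever fewer than `k` vertices are deleted. -/
def IsKConnected {V : Type*} (k : ℕ) (G : SimpleGraph V) : Prop :=
  (k : ℕ∞) < ENat.card V ∧
    ∀ S : Finset V, S.card < k → (G.induce {v : V | v ∉ S}).Connected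

end SimpleGraph

namespace SimpleGraph

/-! Read the word cyclically, as a function on `ℤ` of period `N = 2|V|`; the two positions of a
letter are the ends of a chord. The letters occurring once in a segment are the chords leaving it.
For an open arc of a chord these are the neighbours of its letter (`neighborFinset_eq`), hence three
in number. For any other segment with at least three positions inside and outside, deleting them
separates the letters inside from those outside, so 3-connectedness makes them at least three
(`three_le_card_singleLetters`).

Two crossing chords cut the circle into four gaps. An uncrossing inequality
(`card_singleLetters_add_le`) shows that opposite gaps cannot both be long (`opposite_gaps`). With
parity, if `N ≥ 10` then one of two crossing chords is short, that is, has ends at distance 4,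
unless `N = 12` and all gaps equal 3 (`short_of_crossing`).

Counting neighbours then finishes the proof. A short chord exists (`exists_short`), and short chords
repeat at every shift by 3 (`shift_three_of_short`). The middle letter of a short chord would have
at most two neighbours unless `N = 12` and its ends are antipodal (`middle_antipodal`). This
determines the whole word, whose graph is `K₃,₃`. The remaining case `|V| = 4` is `K₄`. -/

/-- The number of occurrences of the letter `v` at the positions in `[s, t)` of the word `u`. -/
noncomputable def letterCount {V : Type*} [DecidableEq V] (u : ℤ → V) (s t : ℤ) (v : V) : ℕ :=
  ((Finset.Ico s t).filter (fun i => u i = v)).card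

/-! ### Counting letters in segments. -/

section LetterCount

variable {V : Type*} [DecidableEq V] {u : ℤ → V}

theorem letterCount_add (u : ℤ → V) {s m t : ℤ} (h : s ≤ m) (h' : m ≤ t) (v : V) :
    letterCount u s m v + letterCount u m t v = letterCount u s t v := by
  unfold letterCount
  rw [← Finset.Ico_union_Ico_eq_Ico h h', Finset.filter_union, Finset.card_union_of_disjoint]
  exact Finset.disjoint_filter_filter (Finset.Ico_disjoint_Ico_consecutive s m t)

theorem letterCount_single (u : ℤ → V) (s : ℤ) (v : V) :
    letterCount u s (s + 1) v = if u s = v then 1 else 0 := by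
  have : Finset.Ico s (s + 1) = {s} := by ext; simp; omega
  unfold letterCount
  rw [this, Finset.filter_singleton]
  split_ifs <;> simp

theorem letterCount_pos_iff {s t : ℤ} {v : V} :
    0 < letterCount u s t v ↔ ∃ i, s ≤ i ∧ i < t ∧ u i = v := by
  unfold letterCount
  rw [Finset.card_pos]
  constructor
  · rintro ⟨i, hi⟩
    simp only [Finset.mem_filter, Finset.mem_Ico] at hi
    exact ⟨i, hi.1.1, hi.1.2, hi.2⟩
  · rintro ⟨i, h1, h2, h3⟩
    exact ⟨i, by simp [h1, h2, h3]⟩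

theorem letterCount_pos {s t : ℤ} {v : V} (i : ℤ) (h : s ≤ i) (h' : i < t) (hi : u i = v) :
    0 < letterCount u s t v :=
  letterCount_pos_iff.2 ⟨i, h, h', hi⟩

theorem letterCount_mono (u : ℤ → V) {s s' t t' : ℤ} (h : s' ≤ s) (h' : t ≤ t') (v : V) :
    letterCount u s t v ≤ letterCount u s' t' v :=
  Finset.card_le_card (Finset.filter_subset_filter _ (Finset.Ico_subset_Ico h h'))

theorem sum_letterCount [Fintype V] (u : ℤ → V) (s t : ℤ) :
    ∑ v, letterCount u s t v = (t - s).toNat := by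
  unfold letterCount
  rw [← Finset.card_eq_sum_card_fiberwise (fun _ _ => Finset.mem_univ _), Int.card_Ico]

theorem letterCount_shift {N : ℤ} (h : ∀ i, u (i + N) = u i) (s t : ℤ) (v : V) :
    letterCount u (s + N) (t + N) v = letterCount u s t v := by
  unfold letterCount
  symm
  refine Finset.card_bij (fun i _ => i + N) ?_ ?_ ?_
  · intro i hi
    simp only [Finset.mem_filter, Finset.mem_Ico] at hi ⊢
    exact ⟨by omega, by rw [h]; exact hi.2⟩
  · intro a _ b _ hab
    simpa using hab
  · intro b hb
    simp only [Finset.mem_filter, Finset.mem_Ico] at hb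
    refine ⟨b - N, ?_, by omega⟩
    simp only [Finset.mem_filter, Finset.mem_Ico]
    refine ⟨by omega, ?_⟩
    rw [← h, sub_add_cancel]
    exact hb.2

end LetterCount

/-- `u` is the periodic extension, with period `N`, of a double occurrence word with interlacement
graph `G`. -/
structure IsPeriodicWord {V : Type*} [DecidableEq V] (G : SimpleGraph V) (N : ℤ) (u : ℤ → V) :
    Prop where
  periodic : ∀ i, u (i + N) = u i
  count : ∀ s v, letterCount u s (s + N) v = 2
  adj : ∀ i k, i < k → k < i + N → u i = u k →
    ∀ b, G.Adj (u i) b ↔ letterCount u (i + 1) k b = 1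

/-! ### Periodic extension of a finite word. -/

section OfList

variable {V : Type*}

/-- The periodic extension of a nonempty word. -/
def periodicExtension (W : List V) (hW : 0 < W.length) (i : ℤ) : V :=
  W[(i % W.length).toNat]'(by
    have := Int.emod_nonneg i (b := W.length) (by omega)
    have := Int.emod_lt_of_pos i (b := W.length) (by omega)
    omega)

variable {W : List V} {hW : 0 < W.length}

theorem periodicExtension_add_mul (i m : ℤ) :
    periodicExtension W hW (i + W.length * m) = periodicExtension W hW i := by
  simp [periodicExtension]

theorem periodicExtension_natCast {p : ℕ} (hp : p < W.length) :
    periodicExtension W hW p = W[p] := by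
  have : ((p : ℤ) % W.length).toNat = p := by
    rw [Int.emod_eq_of_lt (by omega) (by omega)]; omega
  simp [periodicExtension, this]

theorem sublist_four_iff {a b c d : V} :
    List.Sublist [a, b, c, d] W ↔ ∃ p q r s : ℤ, 0 ≤ p ∧ p < q ∧ q < r ∧ r < s ∧ s < W.length ∧
      periodicExtension W hW p = a ∧ periodicExtension W hW q = b ∧
      periodicExtension W hW r = c ∧ periodicExtension W hW s = d := by
  constructor
  · intro h
    obtain ⟨is, h1, h2⟩ := List.sublist_eq_map_getElem h
    match is, h1, h2 with
    | [p, q, r, s], h1, h2 =>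
      simp only [List.map_cons, List.map_nil, List.cons.injEq, and_true] at h1
      obtain ⟨rfl, rfl, rfl, rfl⟩ := h1
      simp only [List.pairwise_cons, List.mem_cons, List.not_mem_nil] at h2
      have hpq : p < q := h2.1 q (by simp)
      have hqr : q < r := h2.2.1 r (by simp)
      have hrs : r < s := h2.2.2.1 s (by simp)
      refine ⟨p, q, r, s, by omega, by omega, by omega, by omega, by omega, ?_, ?_, ?_, ?_⟩ <;>
        exact periodicExtension_natCast (Fin.is_lt _)
  · rintro ⟨p, q, r, s, h0, h1, h2, h3, h4, rfl, rfl, rfl, rfl⟩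
    lift p to ℕ using h0
    lift q to ℕ using by omega
    lift r to ℕ using by omega
    lift s to ℕ using by omega
    rw [periodicExtension_natCast (by omega), periodicExtension_natCast (by omega),
      periodicExtension_natCast (by omega), periodicExtension_natCast (by omega)]
    have := List.map_getElem_sublist (l := W)
      (is := [⟨p, by omega⟩, ⟨q, by omega⟩, ⟨r, by omega⟩, ⟨s, by omega⟩])
      (by simp; omega)
    simpa using this

variable [DecidableEq V]

theorem letterCount_periodicExtension (p : ℕ) (hp : p ≤ W.length) (v : V) :
    letterCount (periodicExtension W hW) 0 p v = (W.take p).count v := by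
  induction p with
  | zero => simp [letterCount]
  | succ p ih =>
    rw [List.take_succ_eq_append_getElem (by omega), List.count_append, ← ih (by omega)]
    push_cast
    rw [← letterCount_add _ (m := p) (by omega) (by omega), letterCount_single,
      periodicExtension_natCast (by omega), List.count_singleton]
    simp

theorem letterCount_periodicExtension_period (h : IsDoubleOccurrenceWord W) (s : ℤ) (v : V) :
    letterCount (periodicExtension W hW) s (s + W.length) v = 2 := by
  have h0 : letterCount (periodicExtension W hW) 0 W.length v = 2 := by
    rw [letterCount_periodicExtension _ le_rfl, List.take_length, h v]
  -- Moving the window by one place drops and gains the same letter.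
  have step : ∀ s : ℤ, letterCount (periodicExtension W hW) (s + 1) (s + 1 + W.length) v =
      letterCount (periodicExtension W hW) s (s + W.length) v := by
    intro s
    have h1 := letterCount_add (periodicExtension W hW) (s := s) (m := s + 1)
      (t := s + 1 + W.length) (by omega) (by omega) v
    have h2 := letterCount_add (periodicExtension W hW) (s := s) (m := s + W.length)
      (t := s + 1 + W.length) (by omega) (by omega) v
    have h3 := letterCount_shift (u := periodicExtension W hW) (N := W.length)
      (fun i => by simpa using periodicExtension_add_mul (hW := hW) i 1) s (s + 1) v
    omega
  induction s with
  | zero => simpa using h0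
  | succ i ih => rw [step, ih]
  | pred i ih =>
    rw [← step, sub_add_cancel, ih]

end OfList

/-! ### The two arcs of a chord. -/

section Reflect

variable {V : Type*} [DecidableEq V] {u : ℤ → V} {N : ℤ}

/-- A chord meets itself only in its ends, and any other letter occurs twice outside its ends. -/
theorem letterCount_chord (hc : ∀ s v, letterCount u s (s + N) v = 2)
    {i k : ℤ} (hik : i < k) (hk : k < i + N) (h : u i = u k) (b : V) :
    (b = u i → letterCount u (i + 1) k b = 0 ∧ letterCount u (k + 1) (i + N) b = 0) ∧
    (b ≠ u i → letterCount u (i + 1) k b + letterCount u (k + 1) (i + N) b = 2) := by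
  have h0 := hc i b
  have h1 := letterCount_add u (s := i) (m := i + 1) (t := i + N) (by omega) (by omega) b
  have h2 := letterCount_add u (s := i + 1) (m := k) (t := i + N) (by omega) (by omega) b
  have h3 := letterCount_add u (s := k) (m := k + 1) (t := i + N) (by omega) (by omega) b
  rw [letterCount_single] at h1 h3
  rw [← h] at h3
  constructor <;> intro hb
  · subst hb
    simp only [if_true] at h1 h3
    omega
  · rw [if_neg (Ne.symm hb)] at h1 h3
    omega

theorem eq_or_eq_of_chord (hc : ∀ s v, letterCount u s (s + N) v = 2)
    {i k q : ℤ} (hik : i < k) (hk : k < i + N) (h : u i = u k) (hq : u q = u i) (h1 : i ≤ q)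
    (h2 : q < i + N) : q = i ∨ q = k := by
  by_contra hne
  push Not at hne
  obtain ⟨ha, hb⟩ := (letterCount_chord hc hik hk h (u i)).1 rfl
  rcases lt_or_gt_of_ne hne.2 with hlt | hgt
  · have := letterCount_pos q (by omega) hlt hq (s := i + 1)
    omega
  · have := letterCount_pos q (by omega) h2 hq (s := k + 1)
    omega

end Reflect

/-! ### Interlacement read off an arc of a chord. -/

section OfList

variable {V : Type*} [DecidableEq V] {W : List V} {hW : 0 < W.length}

theorem interlacementGraph_adj_iff_of_lt (h : IsDoubleOccurrenceWord W) {i k : ℤ} (hi : 0 ≤ i)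
    (hik : i < k) (hk : k < W.length)
    (heq : periodicExtension W hW i = periodicExtension W hW k) (b : V) :
    (interlacementGraph W).Adj (periodicExtension W hW i) b ↔
      letterCount (periodicExtension W hW) (i + 1) k b = 1 := by
  have hc := letterCount_periodicExtension_period (hW := hW) h
  have hper (i : ℤ) : periodicExtension W hW (i + W.length) = periodicExtension W hW i := by
    simpa using periodicExtension_add_mul (hW := hW) i 1
  have hsplit := letterCount_chord hc hik (by omega) heq b
  have hpos : ∀ q : ℤ, 0 ≤ q → q < W.length → periodicExtension W hW q = periodicExtension W hW i →
      q = i ∨ q = k := by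
    intro q h0 h1 hq
    rcases le_or_gt i q with hiq | hiq
    · exact eq_or_eq_of_chord hc hik (by omega) heq hq hiq (by omega)
    · have := eq_or_eq_of_chord hc hik (by omega) heq ((hper q).trans hq) (by omega) (by omega)
      omega
  constructor
  · rintro ⟨hne, hs⟩
    have h2 := hsplit.2 hne.symm
    rcases hs with hs | hs
    · obtain ⟨p, q, r, s, h0, h1, h2, h3, h4, ha, hb, hc, hd⟩ := (sublist_four_iff (hW := hW)).1 hs
      have := hpos p h0 (by omega) ha
      have := hpos r (by omega) (by omega) hc
      have := letterCount_pos q (by omega) (by omega) hb (s := i + 1) (t := k)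
      have := letterCount_pos s (by omega) (by omega) hd (s := k + 1) (t := i + W.length)
      omega
    · obtain ⟨p, q, r, s, h0, h1, h2, h3, h4, ha, hb, hc, hd⟩ := (sublist_four_iff (hW := hW)).1 hs
      have := hpos q (by omega) (by omega) hb
      have := hpos s (by omega) (by omega) hd
      have := letterCount_pos r (by omega) (by omega) hc (s := i + 1) (t := k)
      have := letterCount_pos (p + W.length) (by omega) (by omega) ((hper p).trans ha)
        (s := k + 1) (t := i + W.length)
      omega
  · intro h1
    have hne : periodicExtension W hW i ≠ b := by
      rintro rfl
      have := (hsplit.1 rfl).1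
      omega
    have h2 := hsplit.2 hne.symm
    refine ⟨hne, ?_⟩
    obtain ⟨j, hj1, hj2, hj⟩ := letterCount_pos_iff.1
      (show 0 < letterCount (periodicExtension W hW) (i + 1) k b by omega)
    obtain ⟨l, hl1, hl2, hl⟩ := letterCount_pos_iff.1
      (show 0 < letterCount (periodicExtension W hW) (k + 1) (i + W.length) b by omega)
    rcases lt_or_ge l (W.length : ℤ) with hlW | hlW
    · exact Or.inl ((sublist_four_iff (hW := hW)).2
        ⟨i, j, k, l, by omega, by omega, by omega, by omega, by omega, rfl, hj, heq.symm, hl⟩)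
    · exact Or.inr ((sublist_four_iff (hW := hW)).2
        ⟨l - W.length, i, j, k, by omega, by omega, by omega, by omega, by omega,
          by rw [← hper, sub_add_cancel]; exact hl, rfl, hj, heq.symm⟩)

theorem isPeriodicWord_periodicExtension (h : IsDoubleOccurrenceWord W) (hW : 0 < W.length) :
    IsPeriodicWord (interlacementGraph W) W.length (periodicExtension W hW) := by
  have hc := letterCount_periodicExtension_period (hW := hW) h
  have hper (i : ℤ) : periodicExtension W hW (i + W.length) = periodicExtension W hW i := by
    simpa using periodicExtension_add_mul (hW := hW) i 1
  refine ⟨hper, hc, ?_⟩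
  have key : ∀ i k : ℤ, 0 ≤ i → i < W.length → i < k → k < i + W.length →
      periodicExtension W hW i = periodicExtension W hW k →
      ∀ b, (interlacementGraph W).Adj (periodicExtension W hW i) b ↔
        letterCount (periodicExtension W hW) (i + 1) k b = 1 := by
    intro i k h0 hi hik hk heq b
    rcases lt_or_ge k (W.length : ℤ) with hkW | hkW
    · exact interlacementGraph_adj_iff_of_lt h h0 hik hkW heq b
    -- The second end lies in the next period. Exchange the ends and pass to the complementary arc,
    -- which contains `b` exactly once iff this one does.
    · have hk' : periodicExtension W hW (k - W.length) = periodicExtension W hW i := by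
        rw [← hper, sub_add_cancel, heq]
      have h1 := interlacementGraph_adj_iff_of_lt h (i := k - W.length) (k := i) (by omega)
        (by omega) hi hk' b
      have hs := letterCount_chord hc (i := k - W.length) (k := i) (by omega) (by omega) hk' b
      rw [sub_add_cancel] at hs
      rw [← hk', h1]
      by_cases hb : b = periodicExtension W hW (k - W.length)
      · have := hs.1 hb
        omega
      · have := hs.2 hb
        omega
  intro i k hik hk heq b
  have e1 := Int.emod_nonneg i (b := W.length) (by omega)
  have e2 := Int.emod_lt_of_pos i (b := W.length) (by omega)
  have e3 := Int.emod_add_mul_ediv i W.length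
  set m := i / W.length
  set i₀ := i % W.length
  have hshift : ∀ t, periodicExtension W hW (t - W.length * m) = periodicExtension W hW t := by
    intro t
    rw [← periodicExtension_add_mul (hW := hW) _ m, sub_add_cancel]
  have := key i₀ (k - W.length * m) e1 e2 (by omega) (by omega)
    (by rw [hshift, ← heq, ← e3, periodicExtension_add_mul]) b
  rw [← e3, periodicExtension_add_mul, this, ← letterCount_shift (N := W.length * m)
    (fun t => periodicExtension_add_mul t m), sub_add_cancel, add_right_comm]

end OfList


/-! ### Cuts, crossing chords and the lengths of gaps. -/

/-- The letters that occur exactly once at the positions in `[s, t)` of the word `u`. -/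
noncomputable def singleLetters {V : Type*} [Fintype V] [DecidableEq V] (u : ℤ → V) (s t : ℤ) :
    Finset V :=
  Finset.univ.filter (fun v => letterCount u s t v = 1)

namespace IsPeriodicWord

variable {V : Type*} [DecidableEq V] {G : SimpleGraph V} {N : ℤ} {u : ℤ → V}

theorem exists_partner (h : IsPeriodicWord G N u) (hN : 0 < N) (i : ℤ) :
    ∃ k, i < k ∧ k < i + N ∧ u i = u k := by
  have h1 := letterCount_add u (s := i) (m := i + 1) (t := i + N) (by omega) (by omega) (u i)
  rw [h.count, letterCount_single, if_pos rfl] at h1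
  obtain ⟨k, hk1, hk2, hk⟩ := letterCount_pos_iff.1
    (show 0 < letterCount u (i + 1) (i + N) (u i) by omega)
  exact ⟨k, by omega, hk2, hk.symm⟩

theorem eq_or_eq (h : IsPeriodicWord G N u) {i k q : ℤ} (hik : i < k) (hk : k < i + N)
    (heq : u i = u k) (hq : u q = u i) (h1 : i ≤ q) (h2 : q < i + N) : q = i ∨ q = k :=
  eq_or_eq_of_chord h.count hik hk heq hq h1 h2

theorem letterCount_eq_two_iff (h : IsPeriodicWord G N u) {s t : ℤ} {v : V} (ht : t ≤ s + N) :
    letterCount u s t v = 2 ↔ ∃ i k, s ≤ i ∧ i < k ∧ k < t ∧ u i = v ∧ u k = v := by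
  constructor
  · intro h2
    unfold letterCount at h2
    obtain ⟨i, hi, k, hk, hne⟩ := Finset.one_lt_card.1 (h2 ▸ Nat.one_lt_two)
    simp only [Finset.mem_filter, Finset.mem_Ico] at hi hk
    rcases lt_or_gt_of_ne hne with hlt | hlt
    · exact ⟨i, k, hi.1.1, hlt, hk.1.2, hi.2, hk.2⟩
    · exact ⟨k, i, hk.1.1, hlt, hi.1.2, hk.2, hi.2⟩
  · rintro ⟨i, k, hi, hik, hk, hui, huk⟩
    have h1 := letterCount_mono u (le_refl s) ht v
    rw [h.count] at h1
    have h2 := letterCount_add u (s := s) (m := k) (t := t) (by omega) (by omega) v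
    have h3 := letterCount_pos i hi hik hui
    have h4 := letterCount_pos k le_rfl hk huk
    omega

variable [Fintype V]

theorem length_eq (h : IsPeriodicWord G N u) (hN : 0 ≤ N) : N = 2 * Fintype.card V := by
  have h1 := sum_letterCount u 0 (0 + N)
  simp only [h.count, Finset.sum_const, Finset.card_univ, smul_eq_mul] at h1
  omega

/-- Every letter occurs an even number of times, up to its single occurrences. -/
theorem length_sub_eq (h : IsPeriodicWord G N u) {s t : ℤ} (hst : s ≤ t) (ht : t ≤ s + N) :
    t - s = (singleLetters u s t).card +
      2 * ((Finset.univ.filter (fun v => letterCount u s t v = 2)).card : ℤ) := by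
  have h1 := sum_letterCount u s t
  have h2 : ∀ v, letterCount u s t v = (if letterCount u s t v = 1 then 1 else 0) +
      2 * (if letterCount u s t v = 2 then 1 else 0) := by
    intro v
    have := letterCount_mono u (le_refl s) ht v
    rw [h.count] at this
    split_ifs <;> omega
  rw [Finset.sum_congr rfl (fun v _ => h2 v), Finset.sum_add_distrib, ← Finset.mul_sum,
    Finset.sum_boole, Finset.sum_boole] at h1
  unfold singleLetters
  simp only [Nat.cast_id] at h1
  omega

theorem neighborFinset_eq [DecidableRel G.Adj] (h : IsPeriodicWord G N u) {i k : ℤ} (hik : i < k)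
    (hk : k < i + N) (heq : u i = u k) : G.neighborFinset (u i) = singleLetters u (i + 1) k := by
  ext b
  simp [singleLetters, h.adj i k hik hk heq b]

theorem card_singleLetters_chord [DecidableRel G.Adj] (h : IsPeriodicWord G N u)
    (hG : G.IsRegularOfDegree 3) {i k : ℤ} (hik : i < k) (hk : k < i + N) (heq : u i = u k) :
    (singleLetters u (i + 1) k).card = 3 := by
  rw [← h.neighborFinset_eq hik hk heq, card_neighborFinset_eq_degree, hG.degree_eq]

/-- In a three-connected interlacement graph, every long segment with a long complement contains
at least three letters exactly once. -/
theorem three_le_card_singleLetters (h : IsPeriodicWord G N u) (hG : G.IsKConnected 3) {s t : ℤ}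
    (h3 : 3 ≤ t - s) (h3' : t - s ≤ N - 3) : 3 ≤ (singleLetters u s t).card := by
  by_contra! hlt
  have hconn := hG.2 _ hlt
  have hle : ∀ v, letterCount u s t v ≤ 2 := fun v => by
    have := letterCount_mono u (le_refl s) (show t ≤ s + N by omega) v
    rwa [h.count] at this
  have hmem : ∀ v : V, v ∈ singleLetters u s t ↔ letterCount u s t v = 1 := by simp [singleLetters]
  have hlen := h.length_sub_eq (s := s) (t := t) (by omega) (by omega)
  -- With no letter repeated, the length of the segment would be its number of single letters, which
  -- is below 3. The same count on the complement gives `w`.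
  obtain ⟨v, hv⟩ : ∃ v, letterCount u s t v = 2 := by
    by_contra! hno
    rw [Finset.filter_false_of_mem (fun v _ => hno v)] at hlen
    simp at hlen
    omega
  obtain ⟨w, hw⟩ : ∃ w, letterCount u s t w = 0 := by
    by_contra! hno
    have hlen' := h.length_sub_eq (s := t) (t := s + N) (by omega) (by omega)
    have hadd := fun v => letterCount_add u (s := s) (m := t) (t := s + N)
      (by omega) (by omega) v
    simp only [h.count] at hadd
    rw [Finset.filter_false_of_mem (fun v _ => by have := hadd v; have := hno v; omega)] at hlen'
    have : singleLetters u t (s + N) = singleLetters u s t := by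
      ext v
      have := hadd v
      simp only [singleLetters, Finset.mem_filter_univ]
      omega
    rw [this] at hlen'
    simp at hlen'
    omega
  obtain ⟨p⟩ := hconn.preconnected ⟨v, by simp [hmem, hv]⟩ ⟨w, by simp [hmem, hw]⟩
  -- Walks avoiding the single letters cannot leave the segment: a neighbour of a letter lying twice
  -- inside occurs inside, and not just once, hence twice.
  have key : ∀ {x y : {x : V | x ∉ singleLetters u s t}}
      (_ : (G.induce {x : V | x ∉ singleLetters u s t}).Walk x y),
      letterCount u s t x = 2 → letterCount u s t y = 2 := by
    intro x y q
    induction q with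
    | nil => exact id
    | @cons x y z hxy q ih =>
      intro hx
      apply ih
      obtain ⟨i, k, hi, hik, hk, hui, huk⟩ := (h.letterCount_eq_two_iff (by omega)).1 hx
      have hadj : G.Adj (u i) y := by rw [hui]; exact hxy
      rw [h.adj i k hik (by omega) (hui.trans huk.symm)] at hadj
      have hmono := letterCount_mono u (show s ≤ i + 1 by omega) hk.le y
      have h1 := hle y
      have h2 := y.2
      simp only [Set.mem_ofPred_eq, hmem] at h2
      omega
  have := key p hv
  simp only at this
  omega

/-- Submodularity at a pair of crossing chords. -/
theorem card_singleLetters_add_le [DecidableRel G.Adj] (h : IsPeriodicWord G N u)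
    (hG : G.IsRegularOfDegree 3) {i j k l : ℤ} (hij : i < j) (hjk : j < k) (hkl : k < l)
    (hl : l < i + N) (hik : u i = u k) (hjl : u j = u l) :
    (singleLetters u (i + 1) j).card + (singleLetters u (k + 1) l).card ≤ 4 := by
  have hne : u i ≠ u j := by
    intro heq
    have := h.eq_or_eq (by omega) (by omega) hik heq.symm hij.le (by omega)
    omega
  have hi := h.card_singleLetters_chord hG (i := i) (k := k) (by omega) (by omega) hik
  have hj := h.card_singleLetters_chord hG (i := j) (k := l) (by omega) (by omega) hjl
  -- Crossing chords are adjacent, so each of the two neighbourhoods loses one element. This is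
  -- where the bound `4 = 2 + 2` comes from; the inequality is then checked letter by letter.
  have hi' : ((singleLetters u (i + 1) k).erase (u j)).card = 2 := by
    rw [Finset.card_erase_of_mem, hi]
    rw [← h.neighborFinset_eq (by omega) (by omega) hik, mem_neighborFinset,
      h.adj i k (by omega) (by omega) hik]
    have h1 := (letterCount_chord h.count (i := i) (by omega) (by omega) hik (u j)).2 hne.symm
    have h2 := letterCount_pos (u := u) (s := i + 1) (t := k) j (by omega) (by omega) rfl
    have h3 := letterCount_pos (s := k + 1) (t := i + N) l (by omega) (by omega) hjl.symm
    omega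
  have hj' : ((singleLetters u (j + 1) l).erase (u i)).card = 2 := by
    rw [Finset.card_erase_of_mem, hj]
    rw [← h.neighborFinset_eq (by omega) (by omega) hjl, mem_neighborFinset,
      h.adj j l (by omega) (by omega) hjl]
    have h1 := (letterCount_chord h.count (i := j) (by omega) (by omega) hjl (u i)).2 hne
    have h2 := letterCount_pos (s := j + 1) (t := l) k (by omega) (by omega) hik.symm
    have h3 := letterCount_pos (s := l + 1) (t := j + N) (i + N) (by omega) (by omega)
      (h.periodic i)
    omega
  have hmem : ∀ {s t : ℤ} (v : V), v ∈ singleLetters u s t ↔ letterCount u s t v = 1 := by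
    simp [singleLetters]
  have hcard (s : Finset V) : s.card = ∑ v, if v ∈ s then 1 else 0 := by simp
  rw [show 4 = ((singleLetters u (i + 1) k).erase (u j)).card +
      ((singleLetters u (j + 1) l).erase (u i)).card by omega, hcard, hcard (singleLetters _ _ _),
    hcard (Finset.erase _ _), hcard (Finset.erase _ _), ← Finset.sum_add_distrib,
    ← Finset.sum_add_distrib]
  refine Finset.sum_le_sum fun v _ => ?_
  simp only [hmem, Finset.mem_erase]
  have a0 := h.count (i + 1) v
  have a1 := letterCount_add u (s := i + 1) (m := j) (t := i + 1 + N) (by omega) (by omega) v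
  have a2 := letterCount_add u (s := j) (m := j + 1) (t := i + 1 + N) (by omega) (by omega) v
  have a3 := letterCount_add u (s := j + 1) (m := k) (t := i + 1 + N) (by omega) (by omega) v
  have a4 := letterCount_add u (s := k) (m := k + 1) (t := i + 1 + N) (by omega) (by omega) v
  have a5 := letterCount_add u (s := k + 1) (m := l) (t := i + 1 + N) (by omega) (by omega) v
  have a6 := letterCount_add u (s := l) (m := l + 1) (t := i + 1 + N) (by omega) (by omega) v
  have a7 := letterCount_add u (s := i + 1) (m := j) (t := k) (by omega) (by omega) v
  have a8 := letterCount_add u (s := j) (m := j + 1) (t := k) (by omega) (by omega) v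
  have a9 := letterCount_add u (s := j + 1) (m := k) (t := l) (by omega) (by omega) v
  have a10 := letterCount_add u (s := k) (m := k + 1) (t := l) (by omega) (by omega) v
  rw [letterCount_single] at a2 a4 a6 a8 a10
  rw [← hjl] at a6
  rw [← hik] at a4 a10
  have hi0 := (letterCount_chord h.count (i := i) (by omega) (by omega) hik v).1
  have hj0 := (letterCount_chord h.count (i := j) (by omega) (by omega) hjl v).1
  by_cases hvi : v = u i
  · have b1 := hi0 hvi
    have b2 := letterCount_mono u (show k + 1 ≤ k + 1 by omega) (show l ≤ i + N by omega) v
    rw [if_neg (by omega), if_neg (by omega)]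
    omega
  by_cases hvj : v = u j
  · have b1 := hj0 hvj
    have b2 := letterCount_mono u (show l + 1 ≤ i + 1 + N by omega) (show i + 1 + N ≤ j + N by omega) v
    have b3 := letterCount_mono u (show j + 1 ≤ k + 1 by omega) (show l ≤ l by omega) v
    have b4 := letterCount_shift h.periodic (i + 1) j v
    have b5 := letterCount_mono u (show l + 1 ≤ i + 1 + N by omega) (show j + N ≤ j + N by omega) v
    rw [if_neg (by omega), if_neg (by omega)]
    omega
  rw [if_neg (Ne.symm hvj)] at a2 a6 a8
  rw [if_neg (Ne.symm hvi)] at a4 a10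
  simp only [ne_eq, hvi, hvj, not_false_eq_true, true_and]
  split_ifs <;> omega

theorem four_le_of_eq [DecidableRel G.Adj] (h : IsPeriodicWord G N u)
    (hG : G.IsRegularOfDegree 3) {i k : ℤ} (hik : i < k) (hk : k < i + N) (heq : u i = u k) :
    i + 4 ≤ k ∧ k + 4 ≤ i + N := by
  have key : ∀ {i k : ℤ}, i < k → k < i + N → u i = u k → i + 4 ≤ k := by
    intro i k hik hk heq
    have h1 := h.card_singleLetters_chord hG hik hk heq
    have h2 := h.length_sub_eq (s := i + 1) (t := k) (by omega) (by omega)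
    omega
  exact ⟨key hik hk heq, key hk (by omega) (by rw [h.periodic, heq])⟩

/-- The parity of the length of the arcs of a chord. -/
theorem exists_eq_add_two_mul [DecidableRel G.Adj] (h : IsPeriodicWord G N u)
    (hG : G.IsRegularOfDegree 3) {i k : ℤ} (hik : i < k) (hk : k < i + N) (heq : u i = u k) :
    ∃ m, k = i + 2 * m := by
  have h1 := h.card_singleLetters_chord hG hik hk heq
  have h2 := h.length_sub_eq (s := i + 1) (t := k) (by omega) (by omega)
  exact ⟨2 + ((Finset.univ.filter (fun v => letterCount u (i + 1) k v = 2)).card : ℤ), by omega⟩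

/-- Chords are not too short, so short segments contain each of their letters once. -/
theorem card_singleLetters_of_short [DecidableRel G.Adj] (h : IsPeriodicWord G N u)
    (hG : G.IsRegularOfDegree 3) {s t : ℤ} (hst : s ≤ t) (ht : t ≤ s + 4) (htN : t ≤ s + N) :
    ((singleLetters u s t).card : ℤ) = t - s := by
  have h2 := h.length_sub_eq hst htN
  rw [Finset.filter_false_of_mem, Finset.card_empty] at h2
  · omega
  intro v _ hv
  obtain ⟨i, k, hi, hik, hk, hui, huk⟩ := (h.letterCount_eq_two_iff htN).1 hv
  have := h.four_le_of_eq hG hik (by omega) (hui.trans huk.symm)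
  omega

/-- Two opposite segments cut out by a pair of crossing chords cannot both be long. -/
theorem opposite_gaps [DecidableRel G.Adj] (h : IsPeriodicWord G N u)
    (hG : G.IsRegularOfDegree 3) (hconn : G.IsKConnected 3)
    {i j k l : ℤ} (hij : i < j) (hjk : j < k) (hkl : k < l)
    (hl : l < i + N) (hik : u i = u k) (hjl : u j = u l) :
    (j - i ≤ 3 ∧ l - k ≤ 3) ∨ (j - i ≤ 2 ∧ 4 ≤ l - k) ∨ (4 ≤ j - i ∧ l - k ≤ 2) := by
  have h1 := h.card_singleLetters_add_le hG hij hjk hkl hl hik hjl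
  -- A gap of length `g` has `g - 1` positions strictly inside, so 4 is the least length to which
  -- the connectivity bound applies.
  have a1 : 4 ≤ j - i → 3 ≤ (singleLetters u (i + 1) j).card := fun _ =>
    h.three_le_card_singleLetters hconn (by omega) (by omega)
  have a2 : 4 ≤ l - k → 3 ≤ (singleLetters u (k + 1) l).card := fun _ =>
    h.three_le_card_singleLetters hconn (by omega) (by omega)
  have b1 : j - i ≤ 3 → ((singleLetters u (i + 1) j).card : ℤ) = j - (i + 1) := fun _ =>
    h.card_singleLetters_of_short hG (by omega) (by omega) (by omega)
  have b2 : l - k ≤ 3 → ((singleLetters u (k + 1) l).card : ℤ) = l - (k + 1) := fun _ =>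
    h.card_singleLetters_of_short hG (by omega) (by omega) (by omega)
  omega

/-- Of two crossing chords, one is as short as possible. -/
theorem short_of_crossing [DecidableRel G.Adj] (h : IsPeriodicWord G N u)
    (hG : G.IsRegularOfDegree 3) (hconn : G.IsKConnected 3) (hN : 10 ≤ N)
    {i j k l : ℤ} (hij : i < j) (hjk : j < k) (hkl : k < l)
    (hl : l < i + N) (hik : u i = u k) (hjl : u j = u l) :
    k = i + 4 ∨ l = j + 4 ∨ i + N = k + 4 ∨ j + N = l + 4 ∨
      (N = 12 ∧ j = i + 3 ∧ k = i + 6 ∧ l = i + 9) := by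
  have h1 := h.opposite_gaps hG hconn hij hjk hkl hl hik hjl
  -- The chord from `k` to `i + N` gives the bound for the other two opposite gaps. Arcs are even,
  -- so the four gaps have equal parity; adjacent gaps sum to at least 4, and all four to `N ≥ 10`.
  have hi : u k = u (i + N) := by rw [h.periodic, hik]
  have h2 := h.opposite_gaps hG hconn hjk hkl hl (by omega) hjl hi
  obtain ⟨m, hm⟩ := h.exists_eq_add_two_mul hG (by omega) (by omega) hik
  obtain ⟨m', hm'⟩ := h.exists_eq_add_two_mul hG (by omega) (by omega) hjl
  obtain ⟨n, hn⟩ := h.exists_eq_add_two_mul hG (by omega) (by omega) hi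
  have h3 := h.four_le_of_eq hG (by omega) (by omega) hik
  have h4 := h.four_le_of_eq hG (by omega) (by omega) hjl
  omega

/-- The gap of length 3 before `p + 3` forces the opposite gap, from `p + 4` to the partner of `p +
3`, to be at most 3; the partner cannot be nearer than `p + 7`. -/
theorem shift_three_of_short [DecidableRel G.Adj] (h : IsPeriodicWord G N u)
    (hG : G.IsRegularOfDegree 3) (hconn : G.IsKConnected 3) (hN : 10 ≤ N)
    {p : ℤ} (hp : u p = u (p + 4)) : u (p + 3) = u (p + 7) := by
  obtain ⟨l, hl1, hl2, hl⟩ := h.exists_partner (by omega) (p + 3)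
  have h1 := h.four_le_of_eq hG hl1 hl2 hl
  have h2 := h.opposite_gaps hG hconn (i := p) (j := p + 3) (k := p + 4) (l := l) (by omega)
    (by omega) (by omega) (by omega) hp hl
  obtain ⟨m, hm⟩ := h.exists_eq_add_two_mul hG hl1 hl2 hl
  rw [hl]
  congr 1
  omega

/-- The mirror image, using the gap from `p + 1` to `p + 4`. -/
theorem shift_neg_three_of_short [DecidableRel G.Adj] (h : IsPeriodicWord G N u)
    (hG : G.IsRegularOfDegree 3) (hconn : G.IsKConnected 3) (hN : 10 ≤ N)
    {p : ℤ} (hp : u p = u (p + 4)) : u (p - 3) = u (p + 1) := by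
  obtain ⟨l, hl1, hl2, hl⟩ := h.exists_partner (by omega) (p + 1)
  have h1 := h.four_le_of_eq hG hl1 hl2 hl
  have h2 := h.opposite_gaps hG hconn (i := p + 1) (j := p + 4) (k := l) (l := p + N) (by omega)
    (by omega) (by omega) (by omega) hl (by rw [h.periodic, hp])
  obtain ⟨m, hm⟩ := h.exists_eq_add_two_mul hG hl1 hl2 hl
  obtain ⟨m', hm'⟩ := h.exists_eq_add_two_mul hG (i := p) (k := p + 4) (by omega) (by omega) hp
  obtain ⟨m', hm'⟩ := h.exists_eq_add_two_mul hG (i := p + 4) (k := p + N) (by omega) (by omega)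
    (by rw [h.periodic, hp])
  rw [hl, ← h.periodic]
  congr 1
  omega

end IsPeriodicWord

/-! ### Existence of short chords and their middle letters. -/

namespace IsPeriodicWord

variable {V : Type*} [DecidableEq V] {G : SimpleGraph V} {N : ℤ} {u : ℤ → V}

theorem apply_add_mul (h : IsPeriodicWord G N u) (i m : ℤ) : u (i + N * m) = u i := by
  have := (show Function.Periodic u N from h.periodic).int_mul m i
  rwa [Int.cast_id, mul_comm] at this

theorem ne_of_chord (h : IsPeriodicWord G N u) {i k q : ℤ} (hik : i < k) (hk : k < i + N)
    (heq : u i = u k) (h1 : i < q) (h2 : q < i + N) (hne : q ≠ k) : u q ≠ u i := by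
  intro hq
  have := h.eq_or_eq hik hk heq hq h1.le h2
  omega

theorem exists_eq_add_mul (h : IsPeriodicWord G N u) {i k q : ℤ} (hik : i < k) (hk : k < i + N)
    (heq : u i = u k) (hq : u q = u i) : ∃ m, q = i + N * m ∨ q = k + N * m := by
  have e1 := Int.emod_nonneg (q - i) (b := N) (by omega)
  have e2 := Int.emod_lt_of_pos (q - i) (b := N) (by omega)
  have e3 := Int.emod_add_mul_ediv (q - i) N
  set m := (q - i) / N
  have := h.eq_or_eq hik hk heq (q := q - N * m)
    (by rw [← h.apply_add_mul _ m, sub_add_cancel, hq]) (by omega) (by omega)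
  exact ⟨m, by omega⟩

theorem exists_crossing_of_adj (h : IsPeriodicWord G N u) {i k : ℤ} (hik : i < k)
    (hk : k < i + N) (heq : u i = u k) {b : V} (hb : G.Adj (u i) b) :
    ∃ j l, i < j ∧ j < k ∧ k < l ∧ l < i + N ∧ u j = u l ∧ u j = b := by
  have h1 := (h.adj i k hik hk heq b).1 hb
  have h2 := (letterCount_chord h.count hik hk heq b).2 hb.ne'
  obtain ⟨j, hj1, hj2, hj⟩ := letterCount_pos_iff.1 (show 0 < letterCount u (i + 1) k b by omega)
  obtain ⟨l, hl1, hl2, hl⟩ := letterCount_pos_iff.1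
    (show 0 < letterCount u (k + 1) (i + N) b by omega)
  exact ⟨j, l, by omega, hj2, by omega, hl2, hj.trans hl.symm, hj⟩

theorem adj_of_crossing (h : IsPeriodicWord G N u) {i j k l : ℤ} (hij : i < j) (hjk : j < k)
    (hkl : k < l) (hl : l < i + N) (hik : u i = u k) (hjl : u j = u l) : G.Adj (u i) (u j) := by
  rw [h.adj i k (by omega) (by omega) hik]
  have h1 := (letterCount_chord h.count (by omega) (by omega) hik (u j)).2
    (h.ne_of_chord (by omega) (by omega) hik (by omega) (by omega) (by omega))
  have h2 := letterCount_pos (u := u) (s := i + 1) (t := k) j (by omega) (by omega) rfl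
  have h3 := letterCount_pos (s := k + 1) (t := i + N) l (by omega) (by omega) hjl.symm
  omega

variable [Fintype V] [DecidableRel G.Adj]

/-- Shifting by 3 makes the two short chords collide: `p + 9` would have the partners `p + 5` and `p
+ 13` if the middle letter's chord starts at `p + 2`, and `p + 1` the partners `p - 3` and `p + 5`
if it ends there. -/
theorem middle_not_short (h : IsPeriodicWord G N u) (hG : G.IsRegularOfDegree 3)
    (hconn : G.IsKConnected 3) (hN : 10 ≤ N) {p : ℤ} (hp : u p = u (p + 4)) {q : ℤ}
    (hq : u q = u (p + 2)) : u q ≠ u (q + 4) := by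
  intro hq'
  obtain ⟨m, hm | hm⟩ := h.exists_eq_add_mul (i := q) (k := q + 4) (by omega) (by omega) hq' hq.symm
  · have s2 : u (p + 2) = u (p + 2 + 4) := by
      rw [hm, h.apply_add_mul, add_right_comm, h.apply_add_mul, hq']
    have s5 := h.shift_three_of_short hG hconn hN s2
    have s3 := h.shift_three_of_short hG hconn hN hp
    have s6 := h.shift_three_of_short hG hconn hN (p := p + 3) (by convert s3 using 2; omega)
    have s9 := h.shift_three_of_short hG hconn hN (p := p + 6) (by convert s6 using 2 <;> omega)
    refine h.ne_of_chord (i := p + 5) (k := p + 9) (q := p + 13) (by omega) (by omega)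
      (by convert s5 using 2 <;> omega) (by omega) (by omega) (by omega) ?_
    trans u (p + 9)
    · symm; convert s9 using 2 <;> omega
    · symm; convert s5 using 2 <;> omega
  · have s2 : u (p - 2) = u (p - 2 + 4) := by
      rw [show p - 2 + 4 = p + 2 by omega, ← hq, ← h.apply_add_mul q m]
      congr 1
      omega
    have s1 := h.shift_three_of_short hG hconn hN s2
    have s3 := h.shift_neg_three_of_short hG hconn hN hp
    refine h.ne_of_chord (i := p - 3) (k := p + 1) (q := p + 5) (by omega) (by omega)
      s3 (by omega) (by omega) (by omega) ?_
    rw [s3]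
    symm; convert s1 using 2 <;> omega

/-- Otherwise all crossings are of the exceptional kind, where the crossing chord starts exactly
three places later; the letter at 0 would have a single neighbour. -/
theorem exists_short (h : IsPeriodicWord G N u) (hG : G.IsRegularOfDegree 3)
    (hconn : G.IsKConnected 3) (hN : 10 ≤ N) : ∃ p, u p = u (p + 4) := by
  by_contra! hno
  obtain ⟨k, hk1, hk2, hk⟩ := h.exists_partner (by omega) 0
  have hsub : G.neighborFinset (u 0) ⊆ {u 3} := by
    intro b hb
    rw [mem_neighborFinset] at hb
    obtain ⟨j, l, h1, h2, h3, h4, hjl, rfl⟩ := h.exists_crossing_of_adj hk1 hk2 hk hb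
    have n1 := hno 0
    have n2 := hno j
    have n3 := hno k
    have n4 := hno l
    rcases h.short_of_crossing hG hconn hN h1 h2 h3 h4 hk hjl with e | e | e | e | e
    · rw [← e] at n1; exact absurd hk n1
    · rw [← e] at n2; exact absurd hjl n2
    · rw [← e, h.periodic] at n3; exact absurd hk.symm n3
    · rw [← e, h.periodic] at n4; exact absurd hjl.symm n4
    · rw [e.2.1]; simp
  have := Finset.card_le_card hsub
  rw [card_neighborFinset_eq_degree, hG.degree_eq] at this
  simp at this

/-- The letter in the middle of a short chord has an antipodal partner, and `N = 12`. -/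
theorem middle_antipodal (h : IsPeriodicWord G N u) (hG : G.IsRegularOfDegree 3)
    (hconn : G.IsKConnected 3) (hN : 10 ≤ N) {p : ℤ} (hp : u p = u (p + 4)) :
    N = 12 ∧ u (p + 2) = u (p + 8) := by
  by_contra hno
  have hy {q : ℤ} := h.middle_not_short hG hconn hN hp (q := q)
  obtain ⟨k, hk1, hk2, hk⟩ := h.exists_partner (by omega) (p + 2)
  have hsub : G.neighborFinset (u (p + 2)) ⊆ {u (k - 2), u p} := by
    intro b hb
    rw [mem_neighborFinset] at hb
    obtain ⟨j, l, h1, h2, h3, h4, hjl, rfl⟩ := h.exists_crossing_of_adj hk1 hk2 hk hb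
    rcases h.short_of_crossing hG hconn hN h1 h2 h3 h4 hk hjl with e | e | e | e | e
    · exact absurd (by rw [← e]; exact hk) (hy rfl)
    · have hj : u j = u (j + 4) := by rw [← e]; exact hjl
      -- At offset 1 or 3 inside a short chord, `k` would itself be an end of a short chord by the
      -- shift lemmas, which the middle letter excludes. Only offset 2 remains.
      have n1 : k ≠ j + 1 := by
        rintro rfl
        refine hy (q := j - 3) ?_ ?_
        · rw [h.shift_neg_three_of_short hG hconn hN hj, hk]
        · rw [h.shift_neg_three_of_short hG hconn hN hj]; congr 1; omega
      have n3 : k ≠ j + 3 := by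
        rintro rfl
        refine hy hk.symm ?_
        rw [h.shift_three_of_short hG hconn hN hj]; congr 1; omega
      rw [show j = k - 2 by omega]
      simp
    · exact absurd (by rw [← e, h.periodic]; exact hk.symm) (hy hk.symm)
    · have hl : u l = u (l + 4) := by rw [← e, h.periodic]; exact hjl.symm
      -- The same argument around the other end, taken at `p + 2 + N`; offset 2 now gives the
      -- original short chord.
      have n1 : p + 2 + N ≠ l + 1 := by
        intro e1
        have e2 : u (l + 1) = u (p + 2) := by rw [← e1, h.periodic]
        refine hy (q := l - 3) ?_ ?_
        · rw [h.shift_neg_three_of_short hG hconn hN hl, e2]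
        · rw [h.shift_neg_three_of_short hG hconn hN hl]; congr 1; omega
      have n3 : p + 2 + N ≠ l + 3 := by
        intro e1
        have e2 : u (l + 3) = u (p + 2) := by rw [← e1, h.periodic]
        refine hy e2 ?_
        rw [h.shift_three_of_short hG hconn hN hl]; congr 1; omega
      rw [hjl, show l = p + N by omega, h.periodic]
      simp
    · exact absurd ⟨e.1, by rw [hk]; congr 1; omega⟩ hno
  have := (Finset.card_le_card hsub).trans Finset.card_le_two
  rw [card_neighborFinset_eq_degree, hG.degree_eq] at this
  omega

end IsPeriodicWord

/-! ### Recognising the two graphs. -/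

/-- A cubic graph on six vertices that contains `K₃,₃` is `K₃,₃`. -/
theorem nonempty_iso_completeBipartiteGraph {V : Type*} [Fintype V] {G : SimpleGraph V}
    [DecidableRel G.Adj] (hG : G.IsRegularOfDegree 3) (hcard : Fintype.card V = 6)
    {L R : Fin 3 → V} (hL : Function.Injective L) (hR : Function.Injective R)
    (hLR : ∀ i j, G.Adj (L i) (R j)) :
    Nonempty (G ≃g completeBipartiteGraph (Fin 3) (Fin 3)) := by
  classical
  have key : ∀ {L R : Fin 3 → V}, Function.Injective R → (∀ i j, G.Adj (L i) (R j)) →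
      ∀ i j, ¬ G.Adj (L i) (L j) := by
    intro L R hR hLR i j hij
    have hsub : Finset.univ.image R ⊆ G.neighborFinset (L i) := by
      intro v
      simp only [Finset.mem_image, Finset.mem_univ, true_and, mem_neighborFinset]
      rintro ⟨j, rfl⟩
      exact hLR i j
    have heq := Finset.eq_of_subset_of_card_le hsub (by
      rw [card_neighborFinset_eq_degree, hG.degree_eq, Finset.card_image_of_injective _ hR]
      simp)
    have hj : L j ∈ Finset.univ.image R := by rw [heq]; simpa using hij
    obtain ⟨t, -, ht⟩ := Finset.mem_image.1 hj
    exact (hLR j t).ne ht.symm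
  have hinj : Function.Injective (Sum.elim L R) :=
    hL.sumElim hR fun i j => (hLR i j).ne
  have hbij := (Fintype.bijective_iff_injective_and_card (Sum.elim L R)).2
    ⟨hinj, by simp [hcard]⟩
  refine ⟨RelIso.symm ⟨Equiv.ofBijective _ hbij, ?_⟩⟩
  rintro (i | i) (j | j)
  · simpa using key hR hLR i j
  · simpa using hLR i j
  · simpa using (hLR j i).symm
  · simpa using key hL (fun a b => (hLR b a).symm) i j

theorem nonempty_iso_completeGraph {V : Type*} [Fintype V] {G : SimpleGraph V}
    [DecidableRel G.Adj] (hG : G.IsRegularOfDegree 3) (hcard : Fintype.card V = 4) :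
    Nonempty (G ≃g completeGraph (Fin 4)) := by
  classical
  have htop : G = ⊤ := by
    ext v w
    have hsub : G.neighborFinset v ⊆ Finset.univ.erase v := by
      intro w hw
      simpa using ((mem_neighborFinset _ _ _).1 hw).ne'
    have heq := Finset.eq_of_subset_of_card_le hsub (by
      rw [card_neighborFinset_eq_degree, hG.degree_eq, Finset.card_erase_of_mem (Finset.mem_univ v),
        Finset.card_univ, hcard])
    rw [← mem_neighborFinset, heq]
    simp [eq_comm]
  subst htop
  exact ⟨Iso.completeGraph (Fintype.equivFinOfCardEq hcard)⟩

theorem injective_vecCons_three {V : Type*} {a b c : V} (hab : a ≠ b) (hac : a ≠ c)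
    (hbc : b ≠ c) : Function.Injective ![a, b, c] := by
  intro i j hij
  fin_cases i <;> fin_cases j <;> simp_all

theorem IsPeriodicWord.nonempty_iso_completeBipartiteGraph {V : Type*} [Fintype V] [DecidableEq V]
    {G : SimpleGraph V} [DecidableRel G.Adj] {N : ℤ} {u : ℤ → V} (h : IsPeriodicWord G N u)
    (hG : G.IsRegularOfDegree 3) (hconn : G.IsKConnected 3) (hN : 10 ≤ N) :
    Nonempty (G ≃g completeBipartiteGraph (Fin 3) (Fin 3)) := by
  obtain ⟨p, hp⟩ := h.exists_short hG hconn hN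
  have h3 := h.shift_three_of_short hG hconn hN hp
  have h6 := h.shift_three_of_short hG hconn hN (p := p + 3) (by convert h3 using 2; omega)
  have h9 := h.shift_three_of_short hG hconn hN (p := p + 6) (by convert h6 using 2 <;> omega)
  obtain ⟨rfl, h2⟩ := h.middle_antipodal hG hconn hN hp
  obtain ⟨-, h5⟩ := h.middle_antipodal hG hconn hN (p := p + 3) (by convert h3 using 2; omega)
  simp only [add_assoc, Int.reduceAdd] at h3 h6 h9 h5
  -- The chord of `p` one period later, needed for its crossing with the chord from `p + 9` to `p +
  -- 13`.
  have h12 : u (p + 12) = u (p + 16) := by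
    rw [h.periodic, hp, show p + 16 = p + 4 + 12 by omega, h.periodic]
  have hcard := h.length_eq (by norm_num)
  have hadj {a b : ℤ} (c d : ℤ) (hac : u (p + a) = u (p + c)) (hbd : u (p + b) = u (p + d))
      (hlt : a < b ∧ b < c ∧ c < d ∧ d < a + 12) : G.Adj (u (p + a)) (u (p + b)) :=
    h.adj_of_crossing (by omega) (by omega) (by omega) (by omega) hac hbd
  have hne {a b : ℤ} (c : ℤ) (hac : u (p + a) = u (p + c))
      (hlt : a < b ∧ b < a + 12 ∧ a < c ∧ c < a + 12 ∧ b ≠ c) : u (p + a) ≠ u (p + b) :=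
    (h.ne_of_chord (by omega) (by omega) hac (by omega) (by omega) (by omega)).symm
  have h0 : u (p + 0) = u (p + 4) := by rw [add_zero, hp]
  have e0 : u (p + 0) = u (p + 12) := by rw [h.periodic, add_zero]
  -- Relative to `p` and modulo 12, the six chords are 0–4, 3–7, 6–10, 9–13, 2–8 and 5–11, which use
  -- all twelve positions.
  refine SimpleGraph.nonempty_iso_completeBipartiteGraph hG (by omega)
    (L := ![u (p + 0), u (p + 6), u (p + 5)]) (R := ![u (p + 3), u (p + 9), u (p + 2)]) ?_ ?_ ?_
  · have n1 := hne (b := 6) 4 h0 (by norm_num)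
    have n2 := hne (b := 5) 4 h0 (by norm_num)
    have n3 := hne (b := 6) 11 h5 (by norm_num)
    exact injective_vecCons_three n1 n2 n3.symm
  · have n1 := hne (b := 9) 7 h3 (by norm_num)
    have n2 := hne (b := 3) 8 h2 (by norm_num)
    have n3 := hne (b := 9) 8 h2 (by norm_num)
    exact injective_vecCons_three n1 n2.symm n3.symm
  · simp only [Fin.forall_fin_succ, IsEmpty.forall_iff, and_true]
    refine ⟨⟨hadj 4 7 h0 h3 (by norm_num), ?_, hadj 4 8 h0 h2 (by norm_num)⟩,
      ⟨(hadj 7 10 h3 h6 (by norm_num)).symm, hadj 10 13 h6 h9 (by norm_num),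
        (hadj 8 10 h2 h6 (by norm_num)).symm⟩,
      ⟨(hadj 7 11 h3 h5 (by norm_num)).symm, hadj 11 13 h5 h9 (by norm_num),
        (hadj 8 11 h2 h5 (by norm_num)).symm⟩⟩
    change G.Adj (u (p + 0)) (u (p + 9))
    rw [e0]
    exact (hadj 13 16 h9 h12 (by norm_num)).symm

end SimpleGraph

theorem corollary4 {V : Type*} [Fintype V] [DecidableEq V] (G : SimpleGraph V)
    [DecidableRel G.Adj] (hcubic : G.IsRegularOfDegree 3) (hcircle : G.IsCircleGraph)
    (hK4 : ¬ Nonempty (G ≃g SimpleGraph.completeGraph (Fin 4)))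
    (hK33 : ¬ Nonempty (G ≃g completeBipartiteGraph (Fin 3) (Fin 3))) :
    ¬ G.IsKConnected 3 := by
  intro hconn
  have hcard : 3 < Fintype.card V := by
    have := hconn.1
    rw [ENat.card_eq_coe_fintype_card] at this
    exact_mod_cast this
  obtain ⟨W, hW, hGW⟩ := hcircle
  have hpos : 0 < W.length := by
    obtain ⟨v⟩ : Nonempty V := Fintype.card_pos_iff.1 (by omega)
    have := List.count_le_length (a := v) (l := W)
    rw [hW v] at this
    omega
  have hword := SimpleGraph.isPeriodicWord_periodicExtension hW hpos
  rw [← hGW] at hword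
  have hlen := hword.length_eq (by omega)
  -- Beyond four vertices, `N = 2|V|` is at least 10, as the short-chord argument requires.
  by_cases h4 : Fintype.card V = 4
  · exact hK4 (SimpleGraph.nonempty_iso_completeGraph hcubic h4)
  · exact hK33 (hword.nonempty_iso_completeBipartiteGraph hcubic hconn (by omega))
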